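/- Let $\hbar,a,b>0$ and $\alpha\in(0,1)$. Order phase-space coordinates as $\gamma=(x_1,x_2,p_1,p_2)$, let $J=\begin{pmatrix}0&I\\-I&0\end{pmatrix}$ be the standard $4\times4$ symplectic matrix and $\Lambda=\mathrm{diag}(1,1,1,-1)$. For a real symmetric positive definite $4\times 4$ matrix $S$, the symplectic spectrum of $S$ is the set of $\lambda>0$ for which $\pm i\lambda$ are eigenvalues of $JS$, and $\lambda_{\min}(S)$ is its least element. For $f\in L^2(\mathbb R^2)$ the Wigner function is $$W(f)(x,p)=\frac1{(2\pi\hbar)^2}\int_{\mathbb R^2}e^{-\frac i\hbar(p_1X_1+p_2X_2)}\,f\!\left(x+\tfrac X2\right)\overline{f\!\left(x-\tfrac X2\right)}\,dX .$$ A wave function $f$ is that of the centred Gaussian state with covariance matrix $\Sigma$ if $\Sigma$ is symmetric positive definite and $W(f)(\gamma)=\frac{1}{(2\pi)^2\sqrt{\det\Sigma}}\exp(-\frac12\gamma^T\Sigma^{-1}\gamma)$. Its logarithmic negativity is $E_{\mathcal L}=\max\bigl(\log\frac{\hbar}{2\lambda_{\min}(\Lambda\Sigma\Lambda^T)},0\bigr)$,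 with the natural logarithm. A unit vector $\psi\in L^2(\mathbb R^2)=L^2(\mathbb R)\otimes L^2(\mathbb R)$ is separable if $|\psi\rangle\langle\psi|$ lies in the trace-norm closed convex hull of the states $|F\rangle\langle F|$ with $F=f\otimes g$, $\|F\|=1$; otherwise it is entangled. Put $$\psi_1(x_1,x_2)=\sqrt{\tfrac{ab}{\pi\alpha}}\,\exp\Bigl[-\tfrac12\Bigl(\tfrac{a^2}{\alpha}x_1^2+\tfrac{b^2}{\alpha}x_2^2\Bigr)\Bigr],\qquad \Sigma_{1,\alpha}=\tfrac12\,\mathrm{diag}\Bigl(\tfrac{\alpha}{a^2},\tfrac{\alpha}{b^2},\tfrac{a^2\hbar^2}{\alpha},\tfrac{b^2\hbar^2}{\alpha}\Bigr),$$ $$\psi_2(x_1,x_2)=\sqrt{\tfrac{ab}{\pi}}\,\exp\Bigl[-\tfrac12\Bigl(\tfrac{1+\alpha^2}{2\alpha}(a^2x_1^2+b^2x_2^2)+\tfrac{1-\alpha^2}{\alpha}ab\,x_1x_2\Bigr)\Bigr],$$ $$\Sigma_{2,\alpha}=\frac1{4\alpha}\begin{pmatrix}\frac{1+\alpha^2}{a^2}&\frac{\alpha^2-1}{ab}&0&0\\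 \frac{\alpha^2-1}{ab}&\frac{1+\alpha^2}{b^2}&0&0\\0&0&(1+\alpha^2)a^2\hbar^2&(1-\alpha^2)ab\hbar^2\\0&0&(1-\alpha^2)ab\hbar^2&(1+\alpha^2)b^2\hbar^2\end{pmatrix},$$ and $\widetilde\Sigma_{k,\alpha}=\Lambda\Sigma_{k,\alpha}\Lambda^T$. Then $\psi_1,\psi_2$ are unit vectors in $L^2(\mathbb R^2)$, and $\psi_k$ is the wave function of the centred Gaussian state with covariance matrix $\Sigma_{k,\alpha}$. Moreover: 1. The eigenvalues of $J\widetilde\Sigma_{1,\alpha}$ are exactly $\pm i\hbar/2$, so the symplectic spectrum of $\widetilde\Sigma_{1,\alpha}$ is $\{\hbar/2\}$ and its minimal symplectic eigenvalue is $\hbar/2$; the criterion $\widetilde\Sigma_{1,\alpha}+\frac{i\hbar}2J\ge0$ holds, and $\psi_1$ is separable. 2. The eigenvalues of $J\widetilde\Sigma_{2,\alpha}$ are exactly $\pm i\frac{\hbar}{2\alpha}$ and $\pm i\frac{\hbar\alpha}{2}$, so the symplectic spectrum of $\widetilde\Sigma_{2,\alpha}$ consists of the two distinct numbers $\frac{\hbar}{2\alpha}$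 and $\frac{\hbar\alpha}2$, and $\lambda_{\min}(\widetilde\Sigma_{2,\alpha})=\frac{\hbar\alpha}{2}$. The criterion fails, both in the form $\lambda_{\min}(\widetilde\Sigma_{2,\alpha})\ge\frac\hbar2$ and in the form $\widetilde\Sigma_{2,\alpha}+\frac{i\hbar}2J\ge0$; $\psi_2$ is entangled, and its logarithmic negativity is $E_{\mathcal L}=\max(-\log\alpha,0)$. -/

import Mathlib

open MeasureTheory Matrix
open scoped ComplexConjugate ComplexOrder ENNReal

noncomputable section

/-! ### Phase space and the symplectic spectrum

Phase-space coordinates of a bipartite system are ordered `(x₁, x₂, p₁, p₂)`. -/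

/-- The standard symplectic matrix `J = [[0, I], [-I, 0]]`. -/
def sympJ : Matrix (Fin 4) (Fin 4) ℝ :=
  !![0, 0, 1, 0; 0, 0, 0, 1; -1, 0, 0, 0; 0, -1, 0, 0]

/-- The mirror reflection `p₂ ↦ -p₂`. -/
def mirror : Matrix (Fin 4) (Fin 4) ℝ := Matrix.diagonal ![1, 1, 1, -1]

/-- The partially transposed covariance matrix `Λ Σ Λᵀ`. -/
def partialTransposeCov (S : Matrix (Fin 4) (Fin 4) ℝ) : Matrix (Fin 4) (Fin 4) ℝ :=
  mirror * S * mirrorᵀ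

/-- The complex number `μ` solves the characteristic equation `det (J S - μ I) = 0`. -/
def IsCharRoot (S : Matrix (Fin 4) (Fin 4) ℝ) (μ : ℂ) : Prop :=
  ((sympJ * S).map Complex.ofReal - μ • (1 : Matrix (Fin 4) (Fin 4) ℂ)).det = 0

/-- The symplectic spectrum of `S`: the positive numbers `l` such that `± i l` are eigenvalues
of `J S`. -/
def symplecticSpectrum (S : Matrix (Fin 4) (Fin 4) ℝ) : Set ℝ :=
  {l | 0 < l ∧ IsCharRoot S (Complex.I * l) ∧ IsCharRoot S (-(Complex.I * l))}

/-- The minimal symplectic eigenvalue. -/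
def minSymplecticEigenvalue (S : Matrix (Fin 4) (Fin 4) ℝ) : ℝ :=
  sInf (symplecticSpectrum S)

/-- The matrix inequality `S + (i ħ / 2) J ≥ 0`. -/
def UncertaintyIneq (hbar : ℝ) (S : Matrix (Fin 4) (Fin 4) ℝ) : Prop :=
  (S.map Complex.ofReal + (Complex.I * (hbar : ℂ) / 2) • sympJ.map Complex.ofReal).PosSemidef

/-- The logarithmic negativity (natural logarithm) of the two-mode Gaussian state with covariance
matrix `S`, in terms of the minimal symplectic eigenvalue of `Λ S Λᵀ`. -/
def logNegativity (hbar : ℝ) (S : Matrix (Fin 4) (Fin 4) ℝ) : ℝ :=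
  max (Real.log (hbar / (2 * minSymplecticEigenvalue (partialTransposeCov S)))) 0

/-! ### Wigner functions and Gaussian states -/

/-- The Wigner distribution function of a bipartite wave function. -/
def wigner (hbar : ℝ) (f : ℝ × ℝ → ℂ) (x p : ℝ × ℝ) : ℂ :=
  1 / (2 * (Real.pi : ℂ) * (hbar : ℂ)) ^ 2 *
    ∫ X : ℝ × ℝ,
      Complex.exp (-(Complex.I / (hbar : ℂ)) * ((p.1 * X.1 + p.2 * X.2 : ℝ) : ℂ)) *
        f (x.1 + X.1 / 2, x.2 + X.2 / 2) * conj (f (x.1 - X.1 / 2, x.2 - X.2 / 2))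

/-- `f` is the wave function of the centred Gaussian state with covariance matrix `S`: the matrix
`S` is symmetric positive definite, and the Wigner function of `f` is the density of the centred
normal law on phase space with covariance matrix `S`. -/
def IsCentredGaussianState (hbar : ℝ) (f : ℝ × ℝ → ℂ) (S : Matrix (Fin 4) (Fin 4) ℝ) : Prop :=
  S.PosDef ∧ ∀ γ : Fin 4 → ℝ,
    wigner hbar f (γ 0, γ 1) (γ 2, γ 3) =
      ((1 / ((2 * Real.pi) ^ 2 * Real.sqrt S.det) *
        Real.exp (-(1 / 2) * (γ ⬝ᵥ (S⁻¹ *ᵥ γ))) : ℝ) : ℂ)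

/-! ### The two wave functions and their covariance matrices -/

/-- The centred wave function obtained by squeezing the two modes separately (`k = 1`). -/
def psi1 (a b α : ℝ) (x : ℝ × ℝ) : ℂ :=
  ((Real.sqrt (a * b / (Real.pi * α)) *
    Real.exp (-(1 / 2) * (a ^ 2 / α * x.1 ^ 2 + b ^ 2 / α * x.2 ^ 2)) : ℝ) : ℂ)

/-- The centred wave function obtained by two-mode squeezing (`k = 2`). -/
def psi2 (a b α : ℝ) (x : ℝ × ℝ) : ℂ :=
  ((Real.sqrt (a * b / Real.pi) *
    Real.exp (-(1 / 2) * ((1 + α ^ 2) / (2 * α) * a ^ 2 * x.1 ^ 2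
      + (1 + α ^ 2) / (2 * α) * b ^ 2 * x.2 ^ 2
      + (1 - α ^ 2) / α * a * b * x.1 * x.2)) : ℝ) : ℂ)

/-- The covariance matrix `Σ_{1,α}`. -/
def cov1 (hbar a b α : ℝ) : Matrix (Fin 4) (Fin 4) ℝ :=
  (1 / 2 : ℝ) • Matrix.diagonal
    ![α / a ^ 2, α / b ^ 2, a ^ 2 * hbar ^ 2 / α, b ^ 2 * hbar ^ 2 / α]

/-- The covariance matrix `Σ_{2,α}`. -/
def cov2 (hbar a b α : ℝ) : Matrix (Fin 4) (Fin 4) ℝ :=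
  (1 / (4 * α)) •
    !![(1 + α ^ 2) / a ^ 2, (α ^ 2 - 1) / (a * b), 0, 0;
       (α ^ 2 - 1) / (a * b), (1 + α ^ 2) / b ^ 2, 0, 0;
       0, 0, (1 + α ^ 2) * a ^ 2 * hbar ^ 2, (1 - α ^ 2) * a * b * hbar ^ 2;
       0, 0, (1 - α ^ 2) * a * b * hbar ^ 2, (1 + α ^ 2) * b ^ 2 * hbar ^ 2]

/-! ### Separability -/

/-- The Hilbert space `L²(ℝ)` of one subsystem. -/
abbrev OneSpace := Lp ℂ 2 (volume : Measure ℝ)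

/-- The Hilbert space `L²(ℝ²) = L²(ℝ) ⊗ L²(ℝ)` of the bipartite system. -/
abbrev TwoSpace := Lp ℂ 2 (volume : Measure (ℝ × ℝ))

/-- `F = f ⊗ g`, that is, `F(x₁, x₂) = f(x₁) g(x₂)` almost everywhere. -/
def IsProductVector (F : TwoSpace) : Prop :=
  ∃ f g : OneSpace, ∀ᵐ x : ℝ × ℝ, F x = f x.1 * g x.2

/-- The density operator `|F⟩⟨F|`. -/
def pureState (F : TwoSpace) : TwoSpace →L[ℂ] TwoSpace :=
  InnerProductSpace.rankOne ℂ F F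

/-- The trace norm, as the supremum of `∑ |⟨eᵢ, T fᵢ⟩|` over finite orthonormal families
(`∞` if `T` is not of trace class). -/
def traceNorm (T : TwoSpace →L[ℂ] TwoSpace) : ℝ≥0∞ :=
  ⨆ (n : ℕ) (e : Fin n → TwoSpace) (f : Fin n → TwoSpace)
    (_ : Orthonormal ℂ e) (_ : Orthonormal ℂ f), ∑ i, ‖inner ℂ (e i) (T (f i))‖ₑ

/-- The pure product states. -/
def pureProductStates : Set (TwoSpace →L[ℂ] TwoSpace) :=
  {ρ | ∃ F : TwoSpace, ‖F‖ = 1 ∧ IsProductVector F ∧ ρ = pureState F}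

/-- A state is separable if it lies in the trace-norm closed convex hull of the product states;
it is entangled if it is not separable. -/
def IsSeparableState (ρ : TwoSpace →L[ℂ] TwoSpace) : Prop :=
  ∀ ε : ℝ≥0∞, 0 < ε → ∃ σ ∈ convexHull ℝ pureProductStates, traceNorm (ρ - σ) < ε

/-- The wave function `f` is square integrable of norm one, and its state is separable. -/
def IsSeparableWave (f : ℝ × ℝ → ℂ) : Prop :=
  ∃ F : TwoSpace, (∀ᵐ x, F x = f x) ∧ ‖F‖ = 1 ∧ IsSeparableState (pureState F)

/-- The wave function `f` is square integrable of norm one, and its state is entangled. -/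
def IsEntangledWave (f : ℝ × ℝ → ℂ) : Prop :=
  ∃ F : TwoSpace, (∀ᵐ x, F x = f x) ∧ ‖F‖ = 1 ∧ ¬ IsSeparableState (pureState F)

end

/-! ### Gaussian integrals in one and two variables -/

/-! Both wave functions are real Gaussians `exp(-½ xᵀAx)`, up to normalization, with `A = [[p, r],
[r, q]]` and `det A = d²`. Their Wigner function is a Gaussian density whose covariance has position
block `½A⁻¹` and momentum block `½ħ²A` (`isCentredGaussianState_gaussianWave`). The mirror
reflection flips the sign of `r` in the momentum block only, so the characteristic polynomial of `J`
times the transposed matrix is biquadratic, and its roots are fixed by `st = ħ²/4` and `s² + t²`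
(`isCharRoot_partialTransposeCov_gaussianCov_iff`). The criterion is settled by an explicit
factorization for `k = 1` and an explicit test vector for `k = 2`.

`ψ₁` has `r = 0` and is visibly a product. Entanglement of `ψ₂` is proved directly on the Hilbert
space, not through the criterion: a Schur test bounds its squared overlap with every product unit
vector by `2 / (c + 1) < 1`, where `c = (1 + α²) / (2α)` (`norm_inner_gaussianWave_le`). This bound
passes to convex combinations of product states, and the trace norm dominates the expectation value
at `ψ₂`, so the state stays a positive distance away (`not_isSeparableState_pureState`). -/

lemma integral_exp_neg_quadratic {q : ℝ} (hq : 0 < q) (l : ℝ) :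
    ∫ y : ℝ, Real.exp (-(q * y ^ 2 + 2 * l * y)) = √(Real.pi / q) * Real.exp (l ^ 2 / q) := by
  have h : ∀ y : ℝ, Real.exp (-(q * y ^ 2 + 2 * l * y)) =
      Real.exp (-q * (y + l / q) ^ 2) * Real.exp (l ^ 2 / q) := fun y => by
    rw [← Real.exp_add]; congr 1; field_simp; ring
  simp_rw [h]
  rw [integral_mul_const, integral_add_right_eq_self (fun y : ℝ => Real.exp (-q * y ^ 2)),
    integral_gaussian]

lemma integrable_exp_neg_quadratic {q : ℝ} (hq : 0 < q) (l : ℝ) :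
    Integrable fun y : ℝ => Real.exp (-(q * y ^ 2 + 2 * l * y)) := by
  have h : ∀ y : ℝ, Real.exp (-(q * y ^ 2 + 2 * l * y)) =
      Real.exp (-q * (y + l / q) ^ 2) * Real.exp (l ^ 2 / q) := fun y => by
    rw [← Real.exp_add]; congr 1; field_simp; ring
  simp_rw [h]
  exact ((integrable_exp_neg_mul_sq hq).comp_add_right (l / q)).mul_const _

lemma integral_cexp_neg_quadratic {q : ℝ} (hq : 0 < q) (c e : ℂ) :
    ∫ y : ℝ, Complex.exp (-(q : ℂ) * (y : ℂ) ^ 2 + c * y + e) =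
      (√(Real.pi / q) : ℝ) * Complex.exp (e + c ^ 2 / (4 * q)) := by
  rw [integral_cexp_quadratic (by simpa using hq)]
  congr 1
  · rw [Real.sqrt_eq_rpow, Complex.ofReal_cpow (by positivity)]
    push_cast
    rw [neg_neg]
  · congr 1
    rw [mul_neg, div_neg, sub_neg_eq_add]

lemma integrable_exp_neg_quadratic_prod {p q r : ℝ} (hq : 0 < q) (hD : 0 < p * q - r ^ 2) :
    Integrable fun z : ℝ × ℝ => Real.exp (-(p * z.1 ^ 2 + 2 * r * z.1 * z.2 + q * z.2 ^ 2)) := by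
  rw [Measure.volume_eq_prod, integrable_prod_iff (by
    apply Continuous.aestronglyMeasurable; fun_prop)]
  have h : ∀ x y : ℝ, Real.exp (-(p * x ^ 2 + 2 * r * x * y + q * y ^ 2)) =
      Real.exp (-p * x ^ 2) * Real.exp (-(q * y ^ 2 + 2 * (r * x) * y)) := fun x y => by
    rw [← Real.exp_add]; congr 1; ring
  simp only [Real.norm_eq_abs, Real.abs_exp]
  simp only [h, integral_const_mul, integral_exp_neg_quadratic hq]
  refine ⟨.of_forall fun x => (integrable_exp_neg_quadratic hq _).const_mul _, ?_⟩
  have h2 : ∀ x : ℝ, Real.exp (-p * x ^ 2) * (√(Real.pi / q) * Real.exp ((r * x) ^ 2 / q)) =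
      √(Real.pi / q) * Real.exp (-((p * q - r ^ 2) / q) * x ^ 2) := fun x => by
    rw [mul_left_comm, ← Real.exp_add]; congr 2; field_simp; ring
  simp_rw [h2]
  exact (integrable_exp_neg_mul_sq (by positivity)).const_mul _

lemma integral_cexp_neg_quadratic_prod {p q r d : ℝ} (hq : 0 < q) (hd : 0 < d)
    (hD : p * q - r ^ 2 = d ^ 2) (k l : ℝ) :
    ∫ z : ℝ × ℝ, Complex.exp (-((p * z.1 ^ 2 + 2 * r * z.1 * z.2 + q * z.2 ^ 2 : ℝ) : ℂ)
        - Complex.I * ((k * z.1 + l * z.2 : ℝ) : ℂ)) =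
      ((Real.pi / d * Real.exp (-(q * k ^ 2 - 2 * r * k * l + p * l ^ 2) / (4 * d ^ 2)) : ℝ) : ℂ)
    := by
  have hq' : (q : ℂ) ≠ 0 := by exact_mod_cast hq.ne'
  have hd' : (d : ℂ) ≠ 0 := by exact_mod_cast hd.ne'
  have hDc : (d : ℂ) ^ 2 = p * q - r ^ 2 := by exact_mod_cast hD.symm
  rw [Measure.volume_eq_prod, integral_prod]
  · have h : ∀ x y : ℝ, Complex.exp (-((p * x ^ 2 + 2 * r * x * y + q * y ^ 2 : ℝ) : ℂ)
        - Complex.I * ((k * x + l * y : ℝ) : ℂ)) =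
        Complex.exp (-(q : ℂ) * (y : ℂ) ^ 2 + (-2 * r * x - Complex.I * l) * y +
          (-p * x ^ 2 - Complex.I * k * x)) := fun x y => by
      congr 1; push_cast; ring
    simp_rw [h, integral_cexp_neg_quadratic hq, integral_const_mul]
    -- Integrating out `y` leaves the Schur complement `(pq - r²)/q = d²/q` as coefficient of `x²`.
    have h2 : ∀ x : ℝ, Complex.exp ((-p * x ^ 2 - Complex.I * k * x) +
        (-2 * r * x - Complex.I * l) ^ 2 / (4 * q)) =
        Complex.exp (-((d ^ 2 / q : ℝ) : ℂ) * (x : ℂ) ^ 2 +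
          (Complex.I * (r * l / q - k)) * x + (-l ^ 2 / (4 * q))) := fun x => by
      congr 1
      push_cast
      rw [hDc]
      field_simp
      ring_nf
      simp only [Complex.I_sq]
      ring
    simp_rw [h2]
    rw [integral_cexp_neg_quadratic (by positivity), ← mul_assoc, ← Complex.ofReal_mul,
      Complex.ofReal_mul (Real.pi / d), Complex.ofReal_exp]
    congr 2
    · rw [← Real.sqrt_mul (by positivity)]
      rw [show Real.pi / q * (Real.pi / (d ^ 2 / q)) = (Real.pi / d) ^ 2 by field_simp]
      exact Real.sqrt_sq (by positivity)
    · push_cast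
      rw [mul_pow, Complex.I_sq]
      field_simp
      rw [hDc]
      ring
  · refine (integrable_exp_neg_quadratic_prod (p := p) (r := r) hq (by rw [hD]; positivity)).mono
      (Continuous.aestronglyMeasurable (by fun_prop)) (.of_forall fun z => ?_)
    rw [Complex.norm_exp, Real.norm_eq_abs, Real.abs_exp, Complex.sub_re, Complex.neg_re,
      Complex.ofReal_re, Complex.I_mul_re, Complex.ofReal_im, neg_zero, sub_zero]

lemma integral_exp_neg_quadratic_prod {p q r d : ℝ} (hq : 0 < q) (hd : 0 < d)
    (hD : p * q - r ^ 2 = d ^ 2) :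
    ∫ z : ℝ × ℝ, Real.exp (-(p * z.1 ^ 2 + 2 * r * z.1 * z.2 + q * z.2 ^ 2)) = Real.pi / d := by
  have h := integral_cexp_neg_quadratic_prod hq hd hD 0 0
  have h2 : ∀ z : ℝ × ℝ, Complex.exp (-((p * z.1 ^ 2 + 2 * r * z.1 * z.2 + q * z.2 ^ 2 : ℝ) : ℂ)
        - Complex.I * ((0 * z.1 + 0 * z.2 : ℝ) : ℂ)) =
      ((Real.exp (-(p * z.1 ^ 2 + 2 * r * z.1 * z.2 + q * z.2 ^ 2)) : ℝ) : ℂ) := fun z => by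
    rw [Complex.ofReal_exp]; congr 1; push_cast; ring
  simp_rw [h2, integral_complex_ofReal] at h
  simpa using Complex.ofReal_injective h

/-! ### Real centred Gaussian wave functions -/

/-- The real centred Gaussian wave function with exponent matrix `[[p, r], [r, q]]`, where `d` is
the square root of the determinant of that matrix. -/
noncomputable def gaussianWave (d p q r : ℝ) (x : ℝ × ℝ) : ℂ :=
  ((√(d / Real.pi) *
    Real.exp (-(1 / 2) * (p * x.1 ^ 2 + q * x.2 ^ 2 + 2 * r * x.1 * x.2)) : ℝ) : ℂ)

lemma continuous_gaussianWave (d p q r : ℝ) : Continuous (gaussianWave d p q r) := by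
  unfold gaussianWave
  fun_prop

lemma norm_sq_gaussianWave {d : ℝ} (hd : 0 < d) (p q r : ℝ) (x : ℝ × ℝ) :
    ‖gaussianWave d p q r x‖ ^ 2 =
      d / Real.pi * Real.exp (-(p * x.1 ^ 2 + 2 * r * x.1 * x.2 + q * x.2 ^ 2)) := by
  rw [gaussianWave, Complex.norm_real, Real.norm_eq_abs, sq_abs, mul_pow,
    Real.sq_sqrt (by positivity), ← Real.exp_nat_mul]
  congr 2
  push_cast
  ring

lemma integrable_norm_sq_gaussianWave {p q r d : ℝ} (hq : 0 < q) (hd : 0 < d)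
    (hD : p * q - r ^ 2 = d ^ 2) : Integrable fun x => ‖gaussianWave d p q r x‖ ^ 2 := by
  simp_rw [norm_sq_gaussianWave hd]
  exact (integrable_exp_neg_quadratic_prod hq (by rw [hD]; positivity)).const_mul _

lemma integral_norm_sq_gaussianWave {p q r d : ℝ} (hq : 0 < q) (hd : 0 < d)
    (hD : p * q - r ^ 2 = d ^ 2) : ∫ x, ‖gaussianWave d p q r x‖ ^ 2 = 1 := by
  simp_rw [norm_sq_gaussianWave hd]
  rw [integral_const_mul, integral_exp_neg_quadratic_prod hq hd hD]
  field_simp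

/-- By the parallelogram law the exponents at `x ± X/2` add up without cross terms: a Gaussian in
`x` factors out, and the Fourier transform of a Gaussian with matrix `A/4` remains, taken at `y/ħ`.
-/
lemma wigner_gaussianWave {hbar p q r d : ℝ} (hh : 0 < hbar) (hq : 0 < q) (hd : 0 < d)
    (hD : p * q - r ^ 2 = d ^ 2) (x y : ℝ × ℝ) :
    wigner hbar (gaussianWave d p q r) x y =
      ((1 / (Real.pi * hbar) ^ 2 * Real.exp (-(p * x.1 ^ 2 + 2 * r * x.1 * x.2 + q * x.2 ^ 2)
        - (q * y.1 ^ 2 - 2 * r * y.1 * y.2 + p * y.2 ^ 2) / (hbar ^ 2 * d ^ 2)) : ℝ) : ℂ) := by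
  have hh' : (hbar : ℂ) ≠ 0 := by exact_mod_cast hh.ne'
  have key : ∀ X : ℝ × ℝ,
      Complex.exp (-(Complex.I / (hbar : ℂ)) * ((y.1 * X.1 + y.2 * X.2 : ℝ) : ℂ)) *
        gaussianWave d p q r (x.1 + X.1 / 2, x.2 + X.2 / 2) *
        conj (gaussianWave d p q r (x.1 - X.1 / 2, x.2 - X.2 / 2)) =
      ((d / Real.pi * Real.exp (-(p * x.1 ^ 2 + 2 * r * x.1 * x.2 + q * x.2 ^ 2)) : ℝ) : ℂ) *
        Complex.exp (-((p / 4 * X.1 ^ 2 + 2 * (r / 4) * X.1 * X.2 + q / 4 * X.2 ^ 2 : ℝ) : ℂ)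
        - Complex.I * ((y.1 / hbar * X.1 + y.2 / hbar * X.2 : ℝ) : ℂ)) := fun X => by
    unfold gaussianWave
    have hs : (((√(d / Real.pi) : ℝ) : ℂ)) ^ 2 = ((d / Real.pi : ℝ) : ℂ) := by
      rw [← Complex.ofReal_pow, Real.sq_sqrt (by positivity)]
    rw [Complex.conj_ofReal, Complex.ofReal_mul, Complex.ofReal_mul, Complex.ofReal_mul, ← hs,
      Complex.ofReal_exp, Complex.ofReal_exp, Complex.ofReal_exp]
    have e : ∀ A B C E : ℂ, A * (B * C) * (B * E) = B ^ 2 * (A * C * E) := fun A B C E => by ring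
    rw [e, mul_assoc (_ ^ 2), ← Complex.exp_add, ← Complex.exp_add, ← Complex.exp_add]
    congr 2
    push_cast
    field_simp
    ring
  unfold wigner
  simp_rw [key]
  rw [integral_const_mul, integral_cexp_neg_quadratic_prod (d := d / 4) (by positivity)
    (by positivity) (by linear_combination hD / 16)]
  have hE : Real.exp (-(p * x.1 ^ 2 + 2 * r * x.1 * x.2 + q * x.2 ^ 2)
        - (q * y.1 ^ 2 - 2 * r * y.1 * y.2 + p * y.2 ^ 2) / (hbar ^ 2 * d ^ 2)) =
      Real.exp (-(p * x.1 ^ 2 + 2 * r * x.1 * x.2 + q * x.2 ^ 2)) *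
      Real.exp (-(q / 4 * (y.1 / hbar) ^ 2 - 2 * (r / 4) * (y.1 / hbar) * (y.2 / hbar) +
        p / 4 * (y.2 / hbar) ^ 2) / (4 * (d / 4) ^ 2)) := by
    rw [← Real.exp_add]
    congr 1
    field_simp
    ring
  rw [hE]
  have hcoef : 1 / (2 * (Real.pi : ℂ) * (hbar : ℂ)) ^ 2 =
      ((1 / (2 * Real.pi * hbar) ^ 2 : ℝ) : ℂ) := by push_cast; ring
  rw [hcoef, ← Complex.ofReal_mul, ← Complex.ofReal_mul]
  congr 1
  have := Real.pi_pos
  field_simp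
  norm_num

/-! ### The covariance matrix and its partial transpose -/

/-- The covariance matrix of `gaussianWave d p q r`. -/
noncomputable def gaussianCov (hbar d p q r : ℝ) : Matrix (Fin 4) (Fin 4) ℝ :=
  !![q / (2 * d ^ 2), -r / (2 * d ^ 2), 0, 0;
     -r / (2 * d ^ 2), p / (2 * d ^ 2), 0, 0;
     0, 0, hbar ^ 2 * p / 2, hbar ^ 2 * r / 2;
     0, 0, hbar ^ 2 * r / 2, hbar ^ 2 * q / 2]

/-- The inverse of `gaussianCov hbar d p q r`. -/
noncomputable def gaussianCovInv (hbar d p q r : ℝ) : Matrix (Fin 4) (Fin 4) ℝ :=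
  !![2 * p, 2 * r, 0, 0;
     2 * r, 2 * q, 0, 0;
     0, 0, 2 * q / (hbar ^ 2 * d ^ 2), -2 * r / (hbar ^ 2 * d ^ 2);
     0, 0, -2 * r / (hbar ^ 2 * d ^ 2), 2 * p / (hbar ^ 2 * d ^ 2)]

lemma quadraticForm_pos {p q r : ℝ} (hp : 0 < p) (hD : 0 < p * q - r ^ 2) {x y : ℝ}
    (h : x ≠ 0 ∨ y ≠ 0) : 0 < p * x ^ 2 + 2 * r * x * y + q * y ^ 2 := by
  have e : p * x ^ 2 + 2 * r * x * y + q * y ^ 2 =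
      ((p * x + r * y) ^ 2 + (p * q - r ^ 2) * y ^ 2) / p := by field_simp; ring
  rw [e]
  apply div_pos _ hp
  by_cases hy : y = 0
  · have hx : x ≠ 0 := by tauto
    subst hy
    have : 0 < (p * x) ^ 2 := by positivity
    simpa using this
  · positivity

lemma posDef_gaussianCov {hbar p q r d : ℝ} (hh : 0 < hbar) (hp : 0 < p) (hq : 0 < q) (hd : 0 < d)
    (hD : p * q - r ^ 2 = d ^ 2) : (gaussianCov hbar d p q r).PosDef := by
  have hD' : 0 < p * q - r ^ 2 := by rw [hD]; positivity
  refine .of_dotProduct_mulVec_pos ?_ fun x hx => ?_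
  · ext i j
    fin_cases i <;> fin_cases j <;> simp [gaussianCov]
  · have e : star x ⬝ᵥ gaussianCov hbar d p q r *ᵥ x =
        (q * x 0 ^ 2 + 2 * (-r) * x 0 * x 1 + p * x 1 ^ 2) / (2 * d ^ 2) +
        hbar ^ 2 / 2 * (p * x 2 ^ 2 + 2 * r * x 2 * x 3 + q * x 3 ^ 2) := by
      simp [gaussianCov, dotProduct, mulVec, Fin.sum_univ_four]
      field_simp
      ring
    rw [e]
    by_cases h : x 0 ≠ 0 ∨ x 1 ≠ 0
    · have h1 := quadraticForm_pos (p := q) (q := p) (r := -r) hq (by linarith) h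
      have h2 : 0 ≤ p * x 2 ^ 2 + 2 * r * x 2 * x 3 + q * x 3 ^ 2 := by
        by_cases h' : x 2 ≠ 0 ∨ x 3 ≠ 0
        · exact (quadraticForm_pos hp hD' h').le
        · push Not at h'
          simp [h'.1, h'.2]
      positivity
    · have h' : x 2 ≠ 0 ∨ x 3 ≠ 0 := by
        by_contra h'
        push Not at h h'
        exact hx (funext fun i => by fin_cases i <;> simp [h.1, h.2, h'.1, h'.2])
      have h2 := quadraticForm_pos hp hD' h'
      push Not at h
      rw [h.1, h.2]
      have : 0 < hbar ^ 2 / 2 * (p * x 2 ^ 2 + 2 * r * x 2 * x 3 + q * x 3 ^ 2) := by positivity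
      simpa using this

/-- The blocks `½A⁻¹` and `½ħ²A` have reciprocal determinants up to scale, so `A` drops out. -/
lemma det_gaussianCov {hbar p q r d : ℝ} (hd : d ≠ 0) (hD : p * q - r ^ 2 = d ^ 2) :
    (gaussianCov hbar d p q r).det = (hbar ^ 2 / 4) ^ 2 := by
  have e : (gaussianCov hbar d p q r).det =
      (hbar ^ 2 / 4) ^ 2 * ((p * q - r ^ 2) / d ^ 2) ^ 2 := by
    simp [gaussianCov, det_succ_row_zero, Fin.sum_univ_succ, Fin.succAbove]
    field_simp
    ring
  rw [e, hD, div_self (by positivity), one_pow, mul_one]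

lemma inv_gaussianCov {hbar p q r d : ℝ} (hh : hbar ≠ 0) (hd : d ≠ 0)
    (hD : p * q - r ^ 2 = d ^ 2) :
    (gaussianCov hbar d p q r)⁻¹ = gaussianCovInv hbar d p q r := by
  apply inv_eq_right_inv
  ext i j
  fin_cases i <;> fin_cases j <;>
    simp [gaussianCov, gaussianCovInv, Matrix.mul_apply, Fin.sum_univ_four] <;> field_simp <;>
    first | ring1 | linear_combination hD

lemma partialTransposeCov_gaussianCov (hbar d p q r : ℝ) :
    partialTransposeCov (gaussianCov hbar d p q r) =
      !![q / (2 * d ^ 2), -r / (2 * d ^ 2), 0, 0;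
        -r / (2 * d ^ 2), p / (2 * d ^ 2), 0, 0;
        0, 0, hbar ^ 2 * p / 2, -(hbar ^ 2 * r / 2);
        0, 0, -(hbar ^ 2 * r / 2), hbar ^ 2 * q / 2] := by
  ext i j
  fin_cases i <;> fin_cases j <;>
    simp [partialTransposeCov, mirror, gaussianCov, Matrix.mul_apply, Matrix.diagonal_apply]

/-- The flipped sign of `r` puts `pq + r²` where the untransposed matrix would give `pq - r² = d²`;
this splits the spectrum when `r ≠ 0`. -/
lemma isCharRoot_partialTransposeCov_gaussianCov {hbar p q r d : ℝ} (hd : d ≠ 0)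
    (hD : p * q - r ^ 2 = d ^ 2) (μ : ℂ) :
    IsCharRoot (partialTransposeCov (gaussianCov hbar d p q r)) μ ↔
      μ ^ 4 + hbar ^ 2 * (p * q + r ^ 2) / (2 * d ^ 2) * μ ^ 2 + (hbar ^ 2 / 4) ^ 2 = 0 := by
  have hd' : (d : ℂ) ≠ 0 := by exact_mod_cast hd
  have hDc : (p * q - r ^ 2 : ℂ) = d ^ 2 := by exact_mod_cast hD
  have hM : (sympJ * partialTransposeCov (gaussianCov hbar d p q r)).map Complex.ofReal
        - μ • (1 : Matrix (Fin 4) (Fin 4) ℂ) =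
      !![-μ, 0, hbar ^ 2 * p / 2, -(hbar ^ 2 * r / 2);
        0, -μ, -(hbar ^ 2 * r / 2), hbar ^ 2 * q / 2;
        -(q / (2 * d ^ 2)), r / (2 * d ^ 2), -μ, 0;
        r / (2 * d ^ 2), -(p / (2 * d ^ 2)), 0, -μ] := by
    rw [partialTransposeCov_gaussianCov]
    ext i j
    fin_cases i <;> fin_cases j <;>
      simp [sympJ] <;> ring
  have e : ((sympJ * partialTransposeCov (gaussianCov hbar d p q r)).map Complex.ofReal
        - μ • (1 : Matrix (Fin 4) (Fin 4) ℂ)).det =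
      μ ^ 4 + hbar ^ 2 * (p * q + r ^ 2) / (2 * d ^ 2) * μ ^ 2 +
        (hbar ^ 2 / 4) ^ 2 * ((p * q - r ^ 2) / d ^ 2) ^ 2 := by
    rw [hM]
    simp [det_succ_row_zero, Fin.sum_univ_succ, Fin.succAbove]
    field_simp
    ring
  rw [IsCharRoot, e, hDc, div_self (by positivity), one_pow, mul_one]

lemma isCentredGaussianState_gaussianWave {hbar p q r d : ℝ} (hh : 0 < hbar) (hp : 0 < p)
    (hq : 0 < q) (hd : 0 < d) (hD : p * q - r ^ 2 = d ^ 2) :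
    IsCentredGaussianState hbar (gaussianWave d p q r) (gaussianCov hbar d p q r) := by
  refine ⟨posDef_gaussianCov hh hp hq hd hD, fun γ => ?_⟩
  rw [wigner_gaussianWave hh hq hd hD, det_gaussianCov hd.ne' hD, Real.sqrt_sq (by positivity),
    inv_gaussianCov hh.ne' hd.ne' hD]
  congr 3
  · field_simp
    norm_num
  · simp [gaussianCovInv, dotProduct, mulVec, Fin.sum_univ_four]
    field_simp
    ring

lemma symplecticSpectrum_eq_of_isCharRoot_iff {S : Matrix (Fin 4) (Fin 4) ℝ} {s t : ℝ}
    (hs : 0 < s) (ht : 0 < t)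
    (h : ∀ μ : ℂ, IsCharRoot S μ ↔ μ = Complex.I * s ∨ μ = -(Complex.I * s) ∨
      μ = Complex.I * t ∨ μ = -(Complex.I * t)) :
    symplecticSpectrum S = {s, t} := by
  ext l
  simp only [symplecticSpectrum, Set.mem_ofPred_eq, Set.mem_insert_iff, Set.mem_singleton_iff]
  constructor
  · rintro ⟨hl, h1, -⟩
    have inj : ∀ u v : ℝ, Complex.I * (u : ℂ) = Complex.I * v → u = v := fun u v e => by
      exact_mod_cast mul_left_cancel₀ Complex.I_ne_zero e
    rcases (h _).1 h1 with e | e | e | e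
    · exact .inl (inj _ _ e)
    · have := inj l (-s) (by rw [e]; push_cast; ring)
      linarith
    · exact .inr (inj _ _ e)
    · have := inj l (-t) (by rw [e]; push_cast; ring)
      linarith
  · rintro (rfl | rfl)
    · exact ⟨hs, (h _).2 (by tauto), (h _).2 (by tauto)⟩
    · exact ⟨ht, (h _).2 (by tauto), (h _).2 (by tauto)⟩

lemma isCharRoot_partialTransposeCov_gaussianCov_iff {hbar p q r d s t : ℝ} (hd : d ≠ 0)
    (hD : p * q - r ^ 2 = d ^ 2) (hst : s * t = hbar ^ 2 / 4)
    (hsum : s ^ 2 + t ^ 2 = hbar ^ 2 * (p * q + r ^ 2) / (2 * d ^ 2)) (μ : ℂ) :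
    IsCharRoot (partialTransposeCov (gaussianCov hbar d p q r)) μ ↔
      μ = Complex.I * s ∨ μ = -(Complex.I * s) ∨ μ = Complex.I * t ∨ μ = -(Complex.I * t) := by
  have hst' : (s * t : ℂ) = hbar ^ 2 / 4 := by exact_mod_cast hst
  have hsum' : (s ^ 2 + t ^ 2 : ℂ) = hbar ^ 2 * (p * q + r ^ 2) / (2 * d ^ 2) := by
    exact_mod_cast hsum
  rw [isCharRoot_partialTransposeCov_gaussianCov hd hD, ← hsum', ← hst',
    ← sub_eq_zero (b := Complex.I * (s : ℂ)), ← sub_eq_zero (b := -(Complex.I * (s : ℂ))),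
    ← sub_eq_zero (b := Complex.I * (t : ℂ)), ← sub_eq_zero (b := -(Complex.I * (t : ℂ))),
    ← mul_eq_zero, ← mul_eq_zero, ← mul_eq_zero]
  have e : (μ - Complex.I * s) * ((μ - -(Complex.I * s)) *
      ((μ - Complex.I * t) * (μ - -(Complex.I * t)))) =
      μ ^ 4 + (s ^ 2 + t ^ 2) * μ ^ 2 + (s * t) ^ 2 := by
    -- The product is `(μ² - I²s²)(μ² - I²t²)`; the coefficient is its difference from the right
    -- side divided by `I² + 1`.
    linear_combination (-μ ^ 2 * (s ^ 2 + t ^ 2) + s ^ 2 * t ^ 2 * (Complex.I ^ 2 - 1)) *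
      Complex.I_sq
  rw [e]

/-- For `r = 0` the two modes decouple and each saturates the inequality: its `2 × 2` block has rank
one, spanned by the corresponding row of `B`. -/
lemma uncertaintyIneq_gaussianCov_diagonal {hbar p q d : ℝ} (hp : 0 < p)
    (hq : 0 < q) (hD : p * q = d ^ 2) :
    UncertaintyIneq hbar (partialTransposeCov (gaussianCov hbar d p q 0)) := by
  let B : Matrix (Fin 2) (Fin 4) ℂ :=
    !![1, 0, Complex.I * hbar * p, 0; 0, 1, 0, Complex.I * hbar * q]
  let W : Matrix (Fin 2) (Fin 2) ℂ := diagonal ![(1 / (2 * p) : ℝ), (1 / (2 * q) : ℝ)]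
  have hp' : (p : ℂ) ≠ 0 := by exact_mod_cast hp.ne'
  have hq' : (q : ℂ) ≠ 0 := by exact_mod_cast hq.ne'
  have hD' : (d : ℂ) ^ 2 = p * q := by exact_mod_cast hD.symm
  have hW : W.PosSemidef := by
    apply PosSemidef.diagonal
    intro i
    fin_cases i
    · exact Complex.zero_le_real.2 (by positivity)
    · exact Complex.zero_le_real.2 (by positivity)
  have h := hW.conjTranspose_mul_mul_same B
  rw [UncertaintyIneq, partialTransposeCov_gaussianCov]
  convert h using 1
  ext i j
  fin_cases i <;> fin_cases j <;>
    simp [B, W, sympJ, Matrix.mul_apply, Fin.sum_univ_two, Matrix.diagonal_apply, hD'] <;>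
    field_simp <;> simp [Complex.I_sq]

/-- On the vector `(a, b, i/(ħa), i/(ħb))` the `J` term contributes `-1` per mode, while the
position and momentum blocks contribute the left sides of `h1` and `h2`. -/
lemma not_uncertaintyIneq_gaussianCov {hbar p q r d a b : ℝ} (hh : 0 < hbar) (ha : 0 < a)
    (hb : 0 < b) (hd : 0 < d)
    (h1 : (q * a ^ 2 - 2 * r * a * b + p * b ^ 2) / (2 * d ^ 2) < 1)
    (h2 : (p / a ^ 2 - 2 * r / (a * b) + q / b ^ 2) / 2 < 1) :
    ¬ UncertaintyIneq hbar (partialTransposeCov (gaussianCov hbar d p q r)) := by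
  intro h
  have ha' : (a : ℂ) ≠ 0 := by exact_mod_cast ha.ne'
  have hb' : (b : ℂ) ≠ 0 := by exact_mod_cast hb.ne'
  have hd' : (d : ℂ) ≠ 0 := by exact_mod_cast hd.ne'
  have hh' : (hbar : ℂ) ≠ 0 := by exact_mod_cast hh.ne'
  rw [UncertaintyIneq, partialTransposeCov_gaussianCov] at h
  have := h.dotProduct_mulVec_nonneg
    ![(a : ℂ), (b : ℂ), Complex.I / (hbar * a), Complex.I / (hbar * b)]
  have e : star ![(a : ℂ), (b : ℂ), Complex.I / (hbar * a), Complex.I / (hbar * b)] ⬝ᵥ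
      (((!![q / (2 * d ^ 2), -r / (2 * d ^ 2), 0, 0;
        -r / (2 * d ^ 2), p / (2 * d ^ 2), 0, 0;
        0, 0, hbar ^ 2 * p / 2, -(hbar ^ 2 * r / 2);
        0, 0, -(hbar ^ 2 * r / 2), hbar ^ 2 * q / 2] :
        Matrix (Fin 4) (Fin 4) ℝ).map Complex.ofReal +
        (Complex.I * (hbar : ℂ) / 2) • sympJ.map Complex.ofReal) *ᵥ
      ![(a : ℂ), (b : ℂ), Complex.I / (hbar * a), Complex.I / (hbar * b)]) =
      (((q * a ^ 2 - 2 * r * a * b + p * b ^ 2) / (2 * d ^ 2) +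
        (p / a ^ 2 - 2 * r / (a * b) + q / b ^ 2) / 2 - 2 : ℝ) : ℂ) := by
    simp [sympJ, dotProduct, mulVec, Fin.sum_univ_four]
    field_simp
    ring_nf
    simp only [Complex.I_sq]
    ring
  rw [e] at this
  have := Complex.zero_le_real.1 this
  linarith

/-! ### Separability and entanglement of pure states -/

lemma lintegral_enorm_sq_eq {X : Type*} [MeasurableSpace X] {μ : Measure X} (f : Lp ℂ 2 μ) :
    ∫⁻ x, ‖f x‖ₑ ^ 2 ∂μ = ‖f‖ₑ ^ 2 := by
  have h := eLpNorm_nnreal_pow_eq_lintegral (f := f) (μ := μ) (p := 2) two_ne_zero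
  rw [Lp.enorm_def]
  simpa using h.symm

lemma exists_Lp_of_integral_norm_sq_eq_one {f : ℝ × ℝ → ℂ} (hf : Continuous f)
    (hi : Integrable fun x => ‖f x‖ ^ 2) (h1 : ∫ x, ‖f x‖ ^ 2 = 1) :
    ∃ F : TwoSpace, (∀ᵐ x, F x = f x) ∧ ‖F‖ = 1 := by
  have hm : MemLp f 2 := (memLp_two_iff_integrable_sq_norm hf.aestronglyMeasurable).2 hi
  refine ⟨hm.toLp f, hm.coeFn_toLp, ?_⟩
  have h := lintegral_enorm_sq_eq (hm.toLp f)
  have h2 : ∫⁻ x, ‖hm.toLp f x‖ₑ ^ 2 = 1 := by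
    rw [lintegral_congr_ae (g := fun x => ENNReal.ofReal (‖f x‖ ^ 2)) ?_,
      ← ofReal_integral_eq_lintegral_ofReal hi (.of_forall fun x => by positivity), h1,
      ENNReal.ofReal_one]
    filter_upwards [hm.coeFn_toLp] with x hx
    rw [hx, ENNReal.ofReal_pow (norm_nonneg _), ofReal_norm]
  rw [h2, ← ofReal_norm, ← ENNReal.ofReal_pow (norm_nonneg _), eq_comm,
    ENNReal.ofReal_eq_one] at h
  exact (pow_eq_one_iff_of_nonneg (norm_nonneg _) two_ne_zero).1 h

lemma traceNorm_zero : traceNorm 0 = 0 := by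
  simp [traceNorm]

lemma isSeparableState_pureState {F : TwoSpace} (h1 : ‖F‖ = 1) (hF : IsProductVector F) :
    IsSeparableState (pureState F) := fun ε hε =>
  ⟨pureState F, subset_convexHull ℝ _ ⟨F, h1, hF, rfl⟩, by rwa [sub_self, traceNorm_zero]⟩

/-- The one-element family `F`, used in both slots, competes in the supremum. -/
lemma enorm_inner_le_traceNorm (T : TwoSpace →L[ℂ] TwoSpace) {F : TwoSpace} (hF : ‖F‖ = 1) :
    ‖inner ℂ F (T F)‖ₑ ≤ traceNorm T := by
  have ho : Orthonormal ℂ (fun _ : Fin 1 => F) :=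
    ⟨fun _ => hF, fun i j hij => absurd (Subsingleton.elim i j) hij⟩
  unfold traceNorm
  refine le_iSup_of_le 1 (le_iSup_of_le (fun _ => F) (le_iSup_of_le (fun _ => F)
    (le_iSup_of_le ho (le_iSup_of_le ho ?_))))
  simp

lemma inner_pureState (F G : TwoSpace) :
    (inner ℂ F (pureState G F)).re = ‖inner ℂ F G‖ ^ 2 := by
  rw [pureState, InnerProductSpace.rankOne_apply, inner_smul_right, ← inner_conj_symm G F,
    ← Complex.normSq_eq_conj_mul_self, Complex.ofReal_re, Complex.normSq_eq_norm_sq]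

/-- A pure state whose overlap with all product vectors is bounded away from one is entangled. -/
lemma not_isSeparableState_pureState {F : TwoSpace} (h1 : ‖F‖ = 1) {c : ℝ} (hc : c < 1)
    (h : ∀ G : TwoSpace, ‖G‖ = 1 → IsProductVector G → ‖inner ℂ F G‖ ^ 2 ≤ c) :
    ¬ IsSeparableState (pureState F) := by
  intro hs
  obtain ⟨σ, hσ, hlt⟩ := hs (ENNReal.ofReal (1 - c)) (ENNReal.ofReal_pos.2 (by linarith))
  -- This half-space contains every pure product state, hence also `σ`, whereas `pureState F` takes
  -- the value `1` there.
  have hconv : Convex ℝ {T : TwoSpace →L[ℂ] TwoSpace | (inner ℂ F (T F)).re ≤ c} := by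
    intro S hS T hT s t hs ht hst
    simp only [Set.mem_ofPred_eq] at hS hT ⊢
    have e : (inner ℂ F ((s • S + t • T) F)).re =
        s * (inner ℂ F (S F)).re + t * (inner ℂ F (T F)).re := by
      rw [_root_.add_apply, _root_.smul_apply, _root_.smul_apply, inner_add_right, Complex.add_re,
        inner_smul_right_eq_smul, inner_smul_right_eq_smul, Complex.smul_re, Complex.smul_re,
        smul_eq_mul, smul_eq_mul]
    rw [e]
    calc _ ≤ s * c + t * c := by gcongr
      _ = c := by rw [← add_mul, hst, one_mul]
  have hmem : (inner ℂ F (σ F)).re ≤ c := by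
    refine convexHull_min ?_ hconv hσ
    rintro _ ⟨G, hG1, hG, rfl⟩
    simpa only [Set.mem_ofPred_eq, inner_pureState] using h G hG1 hG
  have hle := (enorm_inner_le_traceNorm (pureState F - σ) h1).trans_lt hlt
  rw [← ofReal_norm, ENNReal.ofReal_lt_ofReal_iff (by linarith)] at hle
  have hre := (Complex.re_le_norm _).trans_lt hle
  rw [_root_.sub_apply, inner_sub_right, Complex.sub_re, inner_pureState,
    inner_self_eq_norm_sq_to_K, h1] at hre
  norm_num at hre
  linarith

/-! ### The Schur test for product vectors -/

lemma two_mul_le_mul_sq_add_inv_mul_sq (u v : ℝ≥0∞) {c : ℝ≥0∞} (h0 : c ≠ 0) (ht : c ≠ ∞) :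
    2 * (u * v) ≤ c * u ^ 2 + c⁻¹ * v ^ 2 := by
  by_cases hu : u = ∞
  · simp [hu, ENNReal.mul_top h0]
  by_cases hv : v = ∞
  · simp [hv, ENNReal.mul_top (ENNReal.inv_ne_zero.2 ht)]
  lift u to NNReal using hu
  lift v to NNReal using hv
  lift c to NNReal using ht
  have h0' : c ≠ 0 := by exact_mod_cast h0
  rw [← ENNReal.coe_inv h0']
  norm_cast
  have hc : (0 : ℝ) < c := by positivity
  rw [← NNReal.coe_le_coe]
  push_cast
  have e : (c : ℝ) * u ^ 2 + (c : ℝ)⁻¹ * v ^ 2 - 2 * (u * v) = (c * u - v) ^ 2 / c := by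
    field_simp
    ring
  have : 0 ≤ ((c : ℝ) * u - v) ^ 2 / c := by positivity
  linarith

/-- Weighted AM-GM splits `2uv` into `tw·u² + (tw)⁻¹·v²`. Only the product of the two square
integrals is normalized; the factor `t = ∫ v²` balances them, so that each half integrates to at
most `L`. -/
lemma lintegral_mul_mul_le_of_schur {K w : ℝ × ℝ → ℝ≥0∞} (hK : Measurable K) (hw : Measurable w)
    (hw0 : ∀ z, w z ≠ 0) (hwt : ∀ z, w z ≠ ∞) {L : ℝ≥0∞}
    (h1 : ∀ x, ∫⁻ y, K (x, y) * w (x, y) ≤ L) (h2 : ∀ y, ∫⁻ x, K (x, y) * (w (x, y))⁻¹ ≤ L)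
    {u v : ℝ → ℝ≥0∞} (hu : Measurable u) (hv : Measurable v)
    (huv : (∫⁻ x, u x ^ 2) * ∫⁻ y, v y ^ 2 = 1) :
    ∫⁻ z : ℝ × ℝ, K z * (u z.1 * v z.2) ≤ L := by
  set U := ∫⁻ x, u x ^ 2 with hU
  set t := ∫⁻ y, v y ^ 2 with ht
  have ht0 : t ≠ 0 := fun h => by simp [h] at huv
  have hU0 : U ≠ 0 := fun h => by simp [h] at huv
  have htt : t ≠ ∞ := fun h => by simp [h, ENNReal.mul_top hU0] at huv
  have i1 : ∫⁻ z : ℝ × ℝ, K z * (t * w z * u z.1 ^ 2) ≤ L := by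
    rw [Measure.volume_eq_prod, lintegral_prod _ (by fun_prop)]
    calc ∫⁻ x, ∫⁻ y, K (x, y) * (t * w (x, y) * u x ^ 2)
        = ∫⁻ x, t * u x ^ 2 * ∫⁻ y, K (x, y) * w (x, y) := by
          refine lintegral_congr fun x => ?_
          rw [← lintegral_const_mul _ (by fun_prop)]
          exact lintegral_congr fun y => by ring
      _ ≤ ∫⁻ x, t * u x ^ 2 * L := lintegral_mono fun x => by gcongr; exact h1 x
      _ = U * t * L := by
          rw [lintegral_mul_const _ (by fun_prop), lintegral_const_mul _ (by fun_prop),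
            mul_comm t]
      _ = L := by rw [huv, one_mul]
  have i2 : ∫⁻ z : ℝ × ℝ, K z * ((t * w z)⁻¹ * v z.2 ^ 2) ≤ L := by
    rw [Measure.volume_eq_prod, lintegral_prod_symm _ (by fun_prop)]
    calc ∫⁻ y, ∫⁻ x, K (x, y) * ((t * w (x, y))⁻¹ * v y ^ 2)
        = ∫⁻ y, t⁻¹ * v y ^ 2 * ∫⁻ x, K (x, y) * (w (x, y))⁻¹ := by
          refine lintegral_congr fun y => ?_
          rw [← lintegral_const_mul _ (by fun_prop)]
          refine lintegral_congr fun x => ?_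
          rw [ENNReal.mul_inv (.inl ht0) (.inl htt)]
          ring
      _ ≤ ∫⁻ y, t⁻¹ * v y ^ 2 * L := lintegral_mono fun y => by gcongr; exact h2 y
      _ = t⁻¹ * t * L := by
          rw [lintegral_mul_const _ (by fun_prop), lintegral_const_mul _ (by fun_prop)]
      _ = L := by rw [ENNReal.inv_mul_cancel ht0 htt, one_mul]
  have h : 2 * ∫⁻ z : ℝ × ℝ, K z * (u z.1 * v z.2) ≤ 2 * L := by
    rw [← lintegral_const_mul _ (by fun_prop), two_mul L]
    refine le_trans ?_ (add_le_add i1 i2)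
    rw [← lintegral_add_left (by fun_prop)]
    refine lintegral_mono fun z => ?_
    calc 2 * (K z * (u z.1 * v z.2)) = K z * (2 * (u z.1 * v z.2)) := by ring
      _ ≤ K z * (t * w z * u z.1 ^ 2 + (t * w z)⁻¹ * v z.2 ^ 2) := by
          gcongr
          exact two_mul_le_mul_sq_add_inv_mul_sq _ _ (mul_ne_zero ht0 (hw0 z))
            (ENNReal.mul_ne_top htt (hwt z))
      _ = _ := mul_add _ _ _
  exact (ENNReal.mul_le_mul_iff_right two_ne_zero ENNReal.ofNat_ne_top).1 h

lemma norm_inner_le_of_schur {f : ℝ × ℝ → ℂ} (hf : Measurable f) {w : ℝ × ℝ → ℝ≥0∞}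
    (hw : Measurable w) (hw0 : ∀ z, w z ≠ 0) (hwt : ∀ z, w z ≠ ∞) {L : ℝ} (hL : 0 ≤ L)
    (h1 : ∀ x, ∫⁻ y, ‖f (x, y)‖ₑ * w (x, y) ≤ ENNReal.ofReal L)
    (h2 : ∀ y, ∫⁻ x, ‖f (x, y)‖ₑ * (w (x, y))⁻¹ ≤ ENNReal.ofReal L)
    {F G : TwoSpace} (hF : ∀ᵐ x, F x = f x) (hG1 : ‖G‖ = 1) (hG : IsProductVector G) :
    ‖inner ℂ F G‖ ≤ L := by
  obtain ⟨g, h, hgh⟩ := hG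
  have hg : Measurable fun x => ‖g x‖ₑ := (Lp.stronglyMeasurable g).measurable.enorm
  have hh : Measurable fun x => ‖h x‖ₑ := (Lp.stronglyMeasurable h).measurable.enorm
  have huv : (∫⁻ x, ‖g x‖ₑ ^ 2) * ∫⁻ y, ‖h y‖ₑ ^ 2 = 1 := by
    rw [← lintegral_prod_mul (by fun_prop) (by fun_prop), ← Measure.volume_eq_prod]
    have := lintegral_enorm_sq_eq G
    rw [← ofReal_norm, hG1, ENNReal.ofReal_one, one_pow] at this
    rw [← this]
    refine lintegral_congr_ae ?_
    filter_upwards [hgh] with x hx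
    rw [hx, enorm_mul, mul_pow]
  rw [← ENNReal.ofReal_le_ofReal_iff hL, ofReal_norm, L2.inner_def]
  refine (enorm_integral_le_lintegral_enorm _).trans (le_trans (le_of_eq ?_)
    (lintegral_mul_mul_le_of_schur hf.enorm hw hw0 hwt h1 h2 hg hh huv))
  refine lintegral_congr_ae ?_
  filter_upwards [hF, hgh] with x hx hx'
  rw [hx, hx', ← enorm_mul, RCLike.inner_apply, enorm_mul, RCLike.enorm_conj, mul_comm]

/-! ### The two wave functions -/

lemma psi1_eq_gaussianWave (a b α : ℝ) :
    psi1 a b α = gaussianWave (a * b / α) (a ^ 2 / α) (b ^ 2 / α) 0 := by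
  funext x
  rw [psi1, gaussianWave, div_div, mul_comm α]
  congr 4
  ring

lemma cov1_eq_gaussianCov {hbar a b α : ℝ} (ha : 0 < a) (hb : 0 < b) (hα : 0 < α) :
    cov1 hbar a b α = gaussianCov hbar (a * b / α) (a ^ 2 / α) (b ^ 2 / α) 0 := by
  ext i j
  fin_cases i <;> fin_cases j <;> simp [cov1, gaussianCov] <;> field_simp

lemma psi2_eq_gaussianWave (a b α : ℝ) :
    psi2 a b α = gaussianWave (a * b) ((1 + α ^ 2) / (2 * α) * a ^ 2)
      ((1 + α ^ 2) / (2 * α) * b ^ 2) ((1 - α ^ 2) / (2 * α) * a * b) := by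
  funext x
  rw [psi2, gaussianWave]
  congr 5
  ring

lemma cov2_eq_gaussianCov {hbar a b α : ℝ} (ha : 0 < a) (hb : 0 < b) (hα : 0 < α) :
    cov2 hbar a b α = gaussianCov hbar (a * b) ((1 + α ^ 2) / (2 * α) * a ^ 2)
      ((1 + α ^ 2) / (2 * α) * b ^ 2) ((1 - α ^ 2) / (2 * α) * a * b) := by
  ext i j
  fin_cases i <;> fin_cases j <;> simp [cov2, gaussianCov] <;> field_simp <;> ring

lemma isSeparableWave_psi1 {a b α : ℝ} (ha : 0 < a) (hb : 0 < b) (hα : 0 < α) :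
    IsSeparableWave (psi1 a b α) := by
  have hD : a ^ 2 / α * (b ^ 2 / α) - 0 ^ 2 = (a * b / α) ^ 2 := by ring
  obtain ⟨F, hF, h1⟩ := exists_Lp_of_integral_norm_sq_eq_one (continuous_gaussianWave _ _ _ _)
    (integrable_norm_sq_gaussianWave (q := b ^ 2 / α) (d := a * b / α) (by positivity)
      (by positivity) hD)
    (integral_norm_sq_gaussianWave (by positivity) (by positivity) hD)
  have hm : ∀ N c : ℝ, 0 < c →
      MemLp (fun x : ℝ => ((N * Real.exp (-(1 / 2) * (c * x ^ 2)) : ℝ) : ℂ)) 2 := fun N c hc => by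
    rw [memLp_two_iff_integrable_sq_norm (Continuous.aestronglyMeasurable (by fun_prop))]
    have e : ∀ x : ℝ, ‖((N * Real.exp (-(1 / 2) * (c * x ^ 2)) : ℝ) : ℂ)‖ ^ 2 =
        N ^ 2 * Real.exp (-c * x ^ 2) := fun x => by
      rw [Complex.norm_real, Real.norm_eq_abs, sq_abs, mul_pow, ← Real.exp_nat_mul]
      congr 2
      push_cast
      ring
    simp_rw [e]
    exact (integrable_exp_neg_mul_sq hc).const_mul _
  -- The factors of a product vector need not be unit vectors, so the first one carries the whole
  -- normalization.
  have hf := hm √(a * b / (Real.pi * α)) (a ^ 2 / α) (by positivity)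
  have hg := hm 1 (b ^ 2 / α) (by positivity)
  refine ⟨F, by rwa [psi1_eq_gaussianWave], h1,
    isSeparableState_pureState h1 ⟨hf.toLp _, hg.toLp _, ?_⟩⟩
  rw [← psi1_eq_gaussianWave] at hF
  filter_upwards [hF, Measure.quasiMeasurePreserving_fst.ae hf.coeFn_toLp,
    Measure.quasiMeasurePreserving_snd.ae hg.coeFn_toLp] with x hx hx1 hx2
  rw [hx, hx1, hx2, psi1, ← Complex.ofReal_mul, one_mul, mul_assoc, ← Real.exp_add]
  congr 4
  ring

/-- A Gaussian wave function with exponent matrix `[[c a², s a b], [s a b, c b²]]`, `c² - s² = 1`,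
has overlap at most `√(2 / (c + 1))` with every normalized product vector. -/
lemma norm_inner_gaussianWave_le {a b c s : ℝ} (ha : 0 < a) (hb : 0 < b) (hc : 0 < c)
    (hcs : c ^ 2 - s ^ 2 = 1) {F G : TwoSpace}
    (hF : ∀ᵐ x, F x = gaussianWave (a * b) (c * a ^ 2) (c * b ^ 2) (s * a * b) x)
    (hG1 : ‖G‖ = 1) (hG : IsProductVector G) : ‖inner ℂ F G‖ ≤ √(2 / (c + 1)) := by
  have hs : s ^ 2 = (c + 1) * (c - 1) := by linear_combination -hcs
  have hpi := Real.pi_pos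
  have hn : ∀ x, ‖gaussianWave (a * b) (c * a ^ 2) (c * b ^ 2) (s * a * b) x‖ₑ =
      ENNReal.ofReal (√(a * b / Real.pi) * Real.exp (-(1 / 2) * (c * a ^ 2 * x.1 ^ 2 +
        c * b ^ 2 * x.2 ^ 2 + 2 * (s * a * b) * x.1 * x.2))) := fun x => by
    rw [← ofReal_norm, gaussianWave, Complex.norm_real, Real.norm_of_nonneg (by positivity)]
  -- Stated for general `u`, `v` so that both Schur conditions follow, with `(a, b)` and with `(b,
  -- a)`.
  have key : ∀ u v : ℝ, 0 < u → 0 < v → ∀ x : ℝ,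
      ∫⁻ y : ℝ, ENNReal.ofReal (√(u * v / Real.pi) * Real.exp (-(1 / 2) * (c * u ^ 2 * x ^ 2 +
        c * v ^ 2 * y ^ 2 + 2 * (s * u * v) * x * y)) *
        (√(v / u) * Real.exp ((u ^ 2 * x ^ 2 - v ^ 2 * y ^ 2) / 2))) =
      ENNReal.ofReal √(2 / (c + 1)) := fun u v hu hv x => by
    have e : ∀ y : ℝ, √(u * v / Real.pi) * Real.exp (-(1 / 2) * (c * u ^ 2 * x ^ 2 +
        c * v ^ 2 * y ^ 2 + 2 * (s * u * v) * x * y)) *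
        (√(v / u) * Real.exp ((u ^ 2 * x ^ 2 - v ^ 2 * y ^ 2) / 2)) =
        √(u * v / Real.pi) * √(v / u) * Real.exp ((1 - c) * u ^ 2 * x ^ 2 / 2) *
        Real.exp (-((c + 1) * v ^ 2 / 2 * y ^ 2 + 2 * (s * u * v * x / 2) * y)) := fun y => by
      rw [mul_mul_mul_comm, mul_assoc (_ * _) (Real.exp _), ← Real.exp_add, ← Real.exp_add]
      congr 2
      ring
    simp_rw [e]
    have hq : 0 < (c + 1) * v ^ 2 / 2 := by positivity
    rw [← ofReal_integral_eq_lintegral_ofReal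
      ((integrable_exp_neg_quadratic hq _).const_mul _) (.of_forall fun y => by positivity),
      integral_const_mul, integral_exp_neg_quadratic hq]
    congr 1
    -- Here `s² = (c + 1)(c - 1)` makes the dependence on `x` cancel.
    have e2 : (s * u * v * x / 2) ^ 2 / ((c + 1) * v ^ 2 / 2) = -((1 - c) * u ^ 2 * x ^ 2 / 2) := by
      rw [div_pow, mul_pow, mul_pow, mul_pow, hs]
      field_simp
      ring
    rw [e2, Real.exp_neg]
    have e3 : √(u * v / Real.pi) * √(v / u) * √(Real.pi / ((c + 1) * v ^ 2 / 2)) =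
        √(2 / (c + 1)) := by
      rw [← Real.sqrt_mul (by positivity), ← Real.sqrt_mul (by positivity)]
      congr 1
      field_simp
    rw [← e3]
    have := Real.exp_pos ((1 - c) * u ^ 2 * x ^ 2 / 2)
    field_simp
  -- The weight is the quotient of the normalized Gaussians proportional to `exp(-b²y²/2)` and
  -- `exp(-a²x²/2)`. These are a singular pair of the kernel, so the Schur conditions hold with
  -- equality.
  let w : ℝ × ℝ → ℝ := fun z => √(b / a) * Real.exp ((a ^ 2 * z.1 ^ 2 - b ^ 2 * z.2 ^ 2) / 2)
  have hw : ∀ z, 0 < w z := fun z => by positivity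
  refine norm_inner_le_of_schur (w := fun z => ENNReal.ofReal (w z))
    (continuous_gaussianWave _ _ _ _).measurable (by fun_prop)
    (fun z => (ENNReal.ofReal_pos.2 (hw z)).ne') (fun z => ENNReal.ofReal_ne_top)
    (Real.sqrt_nonneg _) (fun x => ?_) (fun y => ?_) hF hG1 hG
  · refine le_of_eq ?_
    rw [← key a b ha hb x]
    refine lintegral_congr fun y => ?_
    rw [hn, ← ENNReal.ofReal_mul (by positivity)]
  · refine le_of_eq ?_
    rw [← key b a hb ha y]
    refine lintegral_congr fun x => ?_
    have hinv : (w (x, y))⁻¹ =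
        √(a / b) * Real.exp ((b ^ 2 * y ^ 2 - a ^ 2 * x ^ 2) / 2) := by
      simp only [w]
      rw [mul_inv, ← Real.sqrt_inv, inv_div, ← Real.exp_neg]
      congr 2
      ring
    rw [hn, ← ENNReal.ofReal_inv_of_pos (hw _), hinv, ← ENNReal.ofReal_mul (by positivity)]
    congr 4
    · rw [mul_comm]
    · ring

/-- Here `c` and `s` are `cosh` and `sinh` of `-log α`; `α < 1` gives `c > 1`, so the overlap bound
is strictly below one. -/
lemma isEntangledWave_psi2 {a b α : ℝ} (ha : 0 < a) (hb : 0 < b) (hα0 : 0 < α) (hα1 : α < 1) :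
    IsEntangledWave (psi2 a b α) := by
  set c := (1 + α ^ 2) / (2 * α) with hc
  set s := (1 - α ^ 2) / (2 * α) with hs
  have hc1 : 1 < c := by
    rw [hc, lt_div_iff₀ (by positivity)]
    nlinarith [sq_pos_of_pos (sub_pos.2 hα1)]
  have hcs : c ^ 2 - s ^ 2 = 1 := by
    rw [hc, hs]
    field_simp
    ring
  have hD : c * a ^ 2 * (c * b ^ 2) - (s * a * b) ^ 2 = (a * b) ^ 2 := by
    linear_combination a ^ 2 * b ^ 2 * hcs
  obtain ⟨F, hF, h1⟩ := exists_Lp_of_integral_norm_sq_eq_one (continuous_gaussianWave _ _ _ _)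
    (integrable_norm_sq_gaussianWave (by positivity) (by positivity) hD)
    (integral_norm_sq_gaussianWave (by positivity) (by positivity) hD)
  refine ⟨F, by rwa [psi2_eq_gaussianWave], h1, not_isSeparableState_pureState h1
    (c := 2 / (c + 1)) (by rw [div_lt_one (by linarith)]; linarith) fun G hG1 hG => ?_⟩
  have := norm_inner_gaussianWave_le ha hb (by linarith) hcs hF hG1 hG
  rwa [Real.le_sqrt (norm_nonneg _) (by positivity)] at this

theorem mainTheorem1 (hbar a b α : ℝ) (hh : 0 < hbar) (ha : 0 < a) (hb : 0 < b)
    (hα0 : 0 < α) (hα1 : α < 1) :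
    -- the case `k = 1`
    (IsCentredGaussianState hbar (psi1 a b α) (cov1 hbar a b α) ∧
      (∀ μ : ℂ, IsCharRoot (partialTransposeCov (cov1 hbar a b α)) μ ↔
        μ = Complex.I * ((hbar / 2 : ℝ) : ℂ) ∨ μ = -(Complex.I * ((hbar / 2 : ℝ) : ℂ))) ∧
      symplecticSpectrum (partialTransposeCov (cov1 hbar a b α)) = {hbar / 2} ∧
      minSymplecticEigenvalue (partialTransposeCov (cov1 hbar a b α)) = hbar / 2 ∧
      UncertaintyIneq hbar (partialTransposeCov (cov1 hbar a b α)) ∧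
      IsSeparableWave (psi1 a b α)) ∧
    -- the case `k = 2`
    (IsCentredGaussianState hbar (psi2 a b α) (cov2 hbar a b α) ∧
      (∀ μ : ℂ, IsCharRoot (partialTransposeCov (cov2 hbar a b α)) μ ↔
        μ = Complex.I * ((hbar / (2 * α) : ℝ) : ℂ) ∨
        μ = -(Complex.I * ((hbar / (2 * α) : ℝ) : ℂ)) ∨
        μ = Complex.I * ((hbar * α / 2 : ℝ) : ℂ) ∨
        μ = -(Complex.I * ((hbar * α / 2 : ℝ) : ℂ))) ∧
      symplecticSpectrum (partialTransposeCov (cov2 hbar a b α)) =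
        {hbar / (2 * α), hbar * α / 2} ∧
      hbar * α / 2 ≠ hbar / (2 * α) ∧
      minSymplecticEigenvalue (partialTransposeCov (cov2 hbar a b α)) = hbar * α / 2 ∧
      ¬ hbar / 2 ≤ minSymplecticEigenvalue (partialTransposeCov (cov2 hbar a b α)) ∧
      ¬ UncertaintyIneq hbar (partialTransposeCov (cov2 hbar a b α)) ∧
      IsEntangledWave (psi2 a b α) ∧
      logNegativity hbar (cov2 hbar a b α) = max (-Real.log α) 0) := by
  have hlt : hbar * α / 2 < hbar / (2 * α) := by
    rw [div_lt_div_iff₀ (by positivity) (by positivity)]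
    nlinarith [mul_pos hh (sub_pos.2 hα1), mul_pos hα0 (sub_pos.2 hα1)]
  have hD1 : a ^ 2 / α * (b ^ 2 / α) - 0 ^ 2 = (a * b / α) ^ 2 := by ring
  have hD2 : (1 + α ^ 2) / (2 * α) * a ^ 2 * ((1 + α ^ 2) / (2 * α) * b ^ 2) -
      ((1 - α ^ 2) / (2 * α) * a * b) ^ 2 = (a * b) ^ 2 := by
    field_simp
    ring
  -- Each root is listed twice: the general lemma is used with `s = t = ħ/2`.
  have hroot1 : ∀ μ : ℂ, IsCharRoot (partialTransposeCov (cov1 hbar a b α)) μ ↔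
      μ = Complex.I * ((hbar / 2 : ℝ) : ℂ) ∨ μ = -(Complex.I * ((hbar / 2 : ℝ) : ℂ)) ∨
      μ = Complex.I * ((hbar / 2 : ℝ) : ℂ) ∨ μ = -(Complex.I * ((hbar / 2 : ℝ) : ℂ)) := by
    rw [cov1_eq_gaussianCov ha hb hα0]
    refine isCharRoot_partialTransposeCov_gaussianCov_iff (by positivity) hD1 (by ring) ?_
    field_simp
    ring
  have hroot2 : ∀ μ : ℂ, IsCharRoot (partialTransposeCov (cov2 hbar a b α)) μ ↔
      μ = Complex.I * ((hbar / (2 * α) : ℝ) : ℂ) ∨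
      μ = -(Complex.I * ((hbar / (2 * α) : ℝ) : ℂ)) ∨
      μ = Complex.I * ((hbar * α / 2 : ℝ) : ℂ) ∨
      μ = -(Complex.I * ((hbar * α / 2 : ℝ) : ℂ)) := by
    rw [cov2_eq_gaussianCov ha hb hα0]
    refine isCharRoot_partialTransposeCov_gaussianCov_iff (by positivity) hD2
      (by field_simp; norm_num) ?_
    field_simp
    ring
  have hspec1 : symplecticSpectrum (partialTransposeCov (cov1 hbar a b α)) = {hbar / 2} := by
    rw [symplecticSpectrum_eq_of_isCharRoot_iff (half_pos hh) (half_pos hh) hroot1,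
      Set.pair_eq_singleton]
  have hspec2 := symplecticSpectrum_eq_of_isCharRoot_iff (by positivity) (by positivity) hroot2
  have hmin2 : minSymplecticEigenvalue (partialTransposeCov (cov2 hbar a b α)) = hbar * α / 2 := by
    rw [minSymplecticEigenvalue, hspec2, csInf_pair, inf_eq_right.2 hlt.le]
  refine ⟨⟨?_, fun μ => (hroot1 μ).trans (by tauto), hspec1, ?_, ?_,
    isSeparableWave_psi1 ha hb hα0⟩, ?_, hroot2, hspec2, hlt.ne, hmin2, ?_, ?_,
    isEntangledWave_psi2 ha hb hα0 hα1, ?_⟩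
  · rw [cov1_eq_gaussianCov ha hb hα0, psi1_eq_gaussianWave]
    exact isCentredGaussianState_gaussianWave hh (by positivity) (by positivity) (by positivity) hD1
  · rw [minSymplecticEigenvalue, hspec1, csInf_singleton]
  · rw [cov1_eq_gaussianCov ha hb hα0]
    exact uncertaintyIneq_gaussianCov_diagonal (by positivity) (by positivity) (by ring)
  · rw [cov2_eq_gaussianCov ha hb hα0, psi2_eq_gaussianWave]
    exact isCentredGaussianState_gaussianWave hh (by positivity) (by positivity) (by positivity) hD2
  · rw [hmin2, not_le]
    have := mul_lt_mul_of_pos_left hα1 hh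
    linarith
  · rw [cov2_eq_gaussianCov ha hb hα0]
    -- Both block contributions equal `α`, so the test vector gives `2α - 2 < 0`.
    refine not_uncertaintyIneq_gaussianCov hh ha hb (by positivity) (lt_of_eq_of_lt ?_ hα1)
      (lt_of_eq_of_lt ?_ hα1)
    · field_simp
      ring
    · field_simp
      ring
  · rw [logNegativity, hmin2, ← Real.log_inv]
    congr 2
    field_simp
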